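/- Let $I\subseteq\mathbb R$ be an interval, bounded or not, and let $\rho=\rho_0$ be a probability density on $I$ such that $L^2(I,\rho)$ (real functions, $\langle f,g\rangle_\rho=\int_I f(t)g(t)\rho(t)\,dt$) has a Hilbert basis $(P_n)_{n\ge 0}$ consisting of polynomials with $\deg P_n=n$. For a density $\sigma$ on $I$ write $S_\sigma(z)=\int_I\frac{\sigma(t)\,dt}{z-t}$. Let $(\rho_n)_{n\ge 0}$ be a sequence of probability densities on $I$ such that, for every $n$, $\rho_{n+1}$ is the normalized secondary density of $\rho_n$, that is, $$d_0^n\,S_{\rho_{n+1}}(z)=z-c_1^n-\frac1{S_{\rho_n}(z)}\qquad (z\in\mathbb C\setminus\overline I),$$ where $c_1^n=\int_I x\rho_n(x)\,dx$, $c_2^n=\int_I x^2\rho_n(x)\,dx$ and $d_0^n=c_2^n-(c_1^n)^2$. Then, for every $n$, the operator $h\mapsto\Big(x\mapsto\int_I\frac{h(t)-h(x)}{t-x}\,\rho_n(t)\,dt\Big)$ on polynomials extends in exactly one way to a continuous linear map $T_{\rho_n}:L^2(I,\rho_n)\to L^2(I,\rho_{n+1})$. Put $F_n=T_{\rho_n}\circ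 T_{\rho_{n-1}}\circ\cdots\circ T_{\rho_0}:L^2(I,\rho_0)\to L^2(I,\rho_{n+1})$. For all $n\ge 0$ and all $f,g\in L^2(I,\rho)$ such that $g$ is orthogonal to $P_0,P_1,\dots,P_n$ in $L^2(I,\rho)$, $$\langle f,g\rangle_{\rho}=d_0^0\,d_0^1\cdots d_0^n\,\langle F_n f,F_n g\rangle_{\rho_{n+1}}.$$ -/

import Mathlib

open MeasureTheory

namespace SecondaryMeasure

/-- `ρ` is a probability density function on `I`. -/
structure IsProbDensity (I : Set ℝ) (ρ : ℝ → ℝ) : Prop where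
  nonneg : ∀ x ∈ I, 0 ≤ ρ x
  integrable : IntegrableOn ρ I
  integral_eq_one : ∫ x in I, ρ x = 1

/-- The measure `ρ(x) dx` on `I`. -/
noncomputable def densMeasure (I : Set ℝ) (ρ : ℝ → ℝ) : Measure ℝ :=
  (volume.restrict I).withDensity (fun x => ENNReal.ofReal (ρ x))

/-- The Hilbert space `L²(I, ρ)` of real functions, with inner product `∫ f g ρ`. -/
noncomputable abbrev L2 (I : Set ℝ) (ρ : ℝ → ℝ) : Type :=
  Lp ℝ 2 (densMeasure I ρ)

/-- The Stieltjes transform of the measure of density `ρ` on `I`. -/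
noncomputable def stieltjes (I : Set ℝ) (ρ : ℝ → ℝ) (z : ℂ) : ℂ :=
  ∫ t in I, (ρ t : ℂ) / (z - (t : ℂ))

/-- The mean `c₁`. -/
noncomputable def c₁ (I : Set ℝ) (ρ : ℝ → ℝ) : ℝ := ∫ x in I, x * ρ x

/-- The second moment `c₂`. -/
noncomputable def c₂ (I : Set ℝ) (ρ : ℝ → ℝ) : ℝ := ∫ x in I, x ^ 2 * ρ x

/-- The variance `d₀ = c₂ - c₁²`. -/
noncomputable def d₀ (I : Set ℝ) (ρ : ℝ → ℝ) : ℝ := c₂ I ρ - c₁ I ρ ^ 2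

/-- `ρ'` is the normalized secondary density of `ρ`: a probability density on `I` such that
`μ = d₀ ρ'` satisfies `S_μ(z) = z - c₁ - 1 / S_ρ(z)` off the (closed) interval. -/
structure IsNormalizedSecondary (I : Set ℝ) (ρ ρ' : ℝ → ℝ) : Prop where
  isProbDensity : IsProbDensity I ρ'
  stieltjes_eq : ∀ z : ℂ, z ∉ ((↑) : ℝ → ℂ) '' closure I →
    (d₀ I ρ : ℂ) * stieltjes I ρ' z = z - (c₁ I ρ : ℂ) - 1 / stieltjes I ρ z

/-- The function `x ↦ ∫ (h(t) - h(x)) / (t - x) ρ(t) dt`. For a polynomial `h` this is the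
secondary polynomial of `h`. -/
noncomputable def secondaryIntegral (I : Set ℝ) (ρ : ℝ → ℝ) (h : ℝ → ℝ) (x : ℝ) : ℝ :=
  ∫ t in I, (h t - h x) / (t - x) * ρ t

/-- `T` is a continuous linear map `L²(I, ρ) → L²(I, ρ')` extending the operator
`h ↦ ∫ (h(t) - h(x)) / (t - x) ρ(t) dt` on polynomials. -/
def IsSecondaryTransform (I : Set ℝ) (ρ ρ' : ℝ → ℝ) (T : L2 I ρ →L[ℝ] L2 I ρ') : Prop :=
  ∀ (p : Polynomial ℝ) (h : L2 I ρ),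
    (h : ℝ → ℝ) =ᵐ[densMeasure I ρ] (fun x => p.eval x) →
    (T h : ℝ → ℝ) =ᵐ[densMeasure I ρ'] secondaryIntegral I ρ (fun x => p.eval x)

open Classical in
/-- The operator `T_ρ : L²(I, ρ) → L²(I, ρ')`, the continuous linear extension of the integral
operator on polynomials (zero if there is none). -/
noncomputable def secondaryTransform (I : Set ℝ) (ρ ρ' : ℝ → ℝ) : L2 I ρ →L[ℝ] L2 I ρ' :=
  if h : ∃ T : L2 I ρ →L[ℝ] L2 I ρ', IsSecondaryTransform I ρ ρ' T then h.choose else 0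

/-- `F_n = T_{ρ_n} ∘ ⋯ ∘ T_{ρ_0}`, from `L²(I, ρ_0)` to `L²(I, ρ_{n+1})`. -/
noncomputable def iteratedTransform (I : Set ℝ) (ρ : ℕ → ℝ → ℝ) :
    (n : ℕ) → (L2 I (ρ 0) →L[ℝ] L2 I (ρ (n + 1)))
  | 0 => secondaryTransform I (ρ 0) (ρ 1)
  | n + 1 => (secondaryTransform I (ρ (n + 1)) (ρ (n + 2))).comp (iteratedTransform I ρ n)

end SecondaryMeasure

/-! Write `r_z(t) = 1/(z - t)`, and let μ, ν be the measures of a density and of its normalized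
secondary density. The relation between the Stieltjes transforms, combined with the identity for
`r_z - r_w`, says that `r_z ↦ S_μ(z) r_z` satisfies `d₀⟨Tf, Tg⟩ = ⟨f, g⟩ - ⟨f, 1⟩⟨1, g⟩` on
resolvents. Resolvents are total in complex L² (`dense_span_resolventLp`), so T extends continuously
to all of L²(μ); its range is dense because `S_μ` has no nonreal zero.

The same T satisfies `T(t f) = x T f + ∫ f dμ`, which follows from its commutator with
multiplication by `r_z` (`apply_mulResolvent`). Together with `T 1 = 0`, this recursion also
determines the integral operator on polynomials, so T is the required extension. Real functions go
to real functions, hence the statement over ℝ.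

T carries polynomials onto polynomials, lowering the degree by one, so polynomial density passes
from each `ρ k` to the next, and with it uniqueness. If g is orthogonal to degrees up to n + 1, then
Tg is orthogonal to degrees up to n. Thus the correction term `⟨f, 1⟩⟨1, g⟩` vanishes at each of the
n + 1 stages and the factors `d₀` multiply (`iteratedTransform_spec`). -/

namespace SecondaryMeasure

/-! ### Injectivity of the Stieltjes transform, by Poisson kernels. -/

open Filter Topology

/-- The density of the standard Cauchy distribution. -/
noncomputable def cauchyKernel (u : ℝ) : ℝ := Real.pi⁻¹ * (1 + u ^ 2)⁻¹

lemma cauchyKernel_nonneg (u : ℝ) : 0 ≤ cauchyKernel u := by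
  unfold cauchyKernel; positivity

lemma continuous_cauchyKernel : Continuous cauchyKernel := by
  unfold cauchyKernel
  exact continuous_const.mul (Continuous.inv₀ (by fun_prop) fun x => by positivity)

lemma cauchyKernel_le_one (u : ℝ) : cauchyKernel u ≤ 1 := by
  unfold cauchyKernel
  refine mul_le_one₀ (inv_le_one_of_one_le₀ (by linarith [Real.pi_gt_three])) (by positivity)
    (inv_le_one_of_one_le₀ (by nlinarith))

lemma integral_cauchyKernel : ∫ u, cauchyKernel u = 1 := by
  unfold cauchyKernel
  rw [integral_const_mul, integral_univ_inv_one_add_sq, inv_mul_cancel₀ Real.pi_ne_zero]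

lemma integral_scaled_cauchyKernel {c : ℝ} (hc : 0 < c) (t : ℝ) :
    ∫ x, c * cauchyKernel (c * (t - x)) = 1 := by
  rw [integral_sub_left_eq_self (fun x => c * cauchyKernel (c * x)) volume t, integral_const_mul,
    Measure.integral_comp_mul_left, integral_cauchyKernel, abs_of_pos (by positivity)]
  simp [hc.ne']

lemma tendsto_norm_mul_cauchyKernel :
    Tendsto (fun x : ℝ => ‖x‖ ^ Module.finrank ℝ ℝ * cauchyKernel x)
      (Bornology.cobounded ℝ) (𝓝 0) := by
  have h1 : Tendsto (fun x : ℝ => ‖x‖⁻¹) (Bornology.cobounded ℝ) (𝓝 0) :=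
    tendsto_inv_atTop_zero.comp tendsto_norm_cobounded_atTop
  refine squeeze_zero (fun x => mul_nonneg (by positivity) (cauchyKernel_nonneg x)) (fun x => ?_) h1
  rw [Module.finrank_self, pow_one]
  rcases eq_or_ne x 0 with rfl | hx
  · simp
  have hx' : 0 < ‖x‖ := norm_pos_iff.2 hx
  have h2 : cauchyKernel x ≤ (‖x‖ ^ 2)⁻¹ := by
    unfold cauchyKernel
    have : (1 + x ^ 2)⁻¹ ≤ (‖x‖ ^ 2)⁻¹ := by
      apply inv_anti₀ (by positivity)
      rw [Real.norm_eq_abs, sq_abs]; linarith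
    calc _ ≤ 1 * (1 + x ^ 2)⁻¹ := by
          gcongr
          exact inv_le_one_of_one_le₀ (by linarith [Real.pi_gt_three])
      _ ≤ _ := by rwa [one_mul]
  calc ‖x‖ * cauchyKernel x ≤ ‖x‖ * (‖x‖ ^ 2)⁻¹ := by gcongr
    _ = ‖x‖⁻¹ := by field_simp

/-- The function `t ↦ 1 / (z - t)`. -/
noncomputable def resolvent (z : ℂ) (t : ℝ) : ℂ := (z - t)⁻¹

lemma sub_ofReal_ne_zero {z : ℂ} (hz : z.im ≠ 0) (t : ℝ) : z - t ≠ 0 := by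
  intro h
  apply hz
  simpa using congrArg Complex.im h

lemma continuous_resolvent {z : ℂ} (hz : z.im ≠ 0) : Continuous (resolvent z) :=
  Continuous.inv₀ (by fun_prop) (sub_ofReal_ne_zero hz)

lemma norm_resolvent_le {z : ℂ} (hz : z.im ≠ 0) (t : ℝ) : ‖resolvent z t‖ ≤ |z.im|⁻¹ := by
  rw [resolvent, norm_inv]
  apply inv_anti₀ (abs_pos.2 hz)
  simpa using Complex.abs_im_le_norm (z - t)

lemma conj_resolvent (z : ℂ) (t : ℝ) :
    (starRingEnd ℂ) (resolvent z t) = resolvent ((starRingEnd ℂ) z) t := by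
  simp [resolvent]

lemma resolvent_sub {z w : ℂ} (hz : z.im ≠ 0) (hw : w.im ≠ 0) (t : ℝ) :
    resolvent z t - resolvent w t = (w - z) * (resolvent z t * resolvent w t) := by
  have h1 := sub_ofReal_ne_zero hz t
  have h2 := sub_ofReal_ne_zero hw t
  unfold resolvent
  field_simp
  ring

/-- The Poisson kernel at height `c⁻¹` is the jump of the resolvent between the two sides of the
real axis. -/
lemma scaled_cauchyKernel_eq {c : ℝ} (hc : 0 < c) (t x : ℝ) :
    ((c * cauchyKernel (c * (t - x)) : ℝ) : ℂ) =
      (2 * Real.pi * Complex.I)⁻¹ * (resolvent (x - (c⁻¹ : ℝ) * Complex.I) t -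
        resolvent (x + (c⁻¹ : ℝ) * Complex.I) t) := by
  have him : ((x : ℂ) - (c⁻¹ : ℝ) * Complex.I).im ≠ 0 := by simp [hc.ne']
  have him' : ((x : ℂ) + (c⁻¹ : ℝ) * Complex.I).im ≠ 0 := by simp [hc.ne']
  rw [resolvent_sub him him']
  have hpi : (Real.pi : ℂ) ≠ 0 := by exact_mod_cast Real.pi_ne_zero
  have hI := Complex.I_ne_zero
  have hc' : (c : ℂ) ≠ 0 := by exact_mod_cast hc.ne'
  have key : resolvent (x - (c⁻¹ : ℝ) * Complex.I) t * resolvent (x + (c⁻¹ : ℝ) * Complex.I) t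
      = (c : ℂ) ^ 2 * (1 + ((c : ℂ) * (t - x)) ^ 2)⁻¹ := by
    unfold resolvent
    rw [← mul_inv, ← inv_inv ((c : ℂ) ^ 2), ← mul_inv]
    congr 1
    push_cast
    field_simp
    linear_combination (-1 : ℂ) * Complex.I_sq
  rw [key]
  unfold cauchyKernel
  push_cast
  field_simp
  ring

/-- A function whose integrals against `1 / (z - t)` vanish for all `z` near the real axis
vanishes almost everywhere. -/
theorem ae_eq_zero_of_integral_resolvent_eq_zero {μ : Measure ℝ} [IsFiniteMeasure μ] {f : ℝ → ℂ}
    (hf : Integrable f μ)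
    (h : ∀ z : ℂ, z.im ≠ 0 → |z.im| < 1 → ∫ t, resolvent z t * f t ∂μ = 0) : f =ᵐ[μ] 0 := by
  refine ae_eq_zero_of_integral_contDiff_smul_eq_zero hf.locallyIntegrable ?_
  intro g hg hgs
  have hgi : Integrable g := hg.continuous.integrable_of_hasCompactSupport hgs
  obtain ⟨M, hM⟩ := hgs.exists_bound_of_continuous hg.continuous
  have hM0 : 0 ≤ M := (norm_nonneg _).trans (hM 0)
  have hprod (c : ℝ) (hc : 0 < c) :
      Integrable (fun q : ℝ × ℝ => (c * cauchyKernel (c * (q.1 - q.2))) • (g q.2 • f q.1))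
        (μ.prod volume) := by
    have h1 : Integrable (fun q : ℝ × ℝ => g q.2 • f q.1) (μ.prod volume) := by
      simpa [mul_comm] using hf.mul_prod hgi.ofReal
    refine Integrable.bdd_smul (𝕜 := ℝ)
      (φ := fun q : ℝ × ℝ => c * cauchyKernel (c * (q.1 - q.2))) h1 c ?_ (ae_of_all _ fun q => ?_)
    · exact (Continuous.aestronglyMeasurable (by have := continuous_cauchyKernel; fun_prop))
    · rw [Real.norm_of_nonneg (mul_nonneg hc.le (cauchyKernel_nonneg _))]
      exact mul_le_of_le_one_right hc.le (cauchyKernel_le_one _)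
  -- The scaled kernels form an approximate identity acting on the test function g; the domination
  -- is by `M * ‖f t‖`, since each kernel has mass 1.
  have hlim : Tendsto (fun c : ℝ => ∫ t, (∫ x, (c * cauchyKernel (c * (t - x))) • (g x • f t)) ∂μ)
      atTop (𝓝 (∫ t, g t • f t ∂μ)) := by
    refine tendsto_integral_filter_of_dominated_convergence (fun t => M * ‖f t‖) ?_ ?_ ?_ ?_
    · filter_upwards [eventually_gt_atTop 0] with c hc
      exact (hprod c hc).integral_prod_left.aestronglyMeasurable
    · filter_upwards [eventually_gt_atTop 0] with c hc
      refine ae_of_all _ fun t => ?_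
      have hint : Integrable fun x => c * cauchyKernel (c * (t - x)) :=
        integrable_of_integral_eq_one (integral_scaled_cauchyKernel hc t)
      calc _ ≤ ∫ x, (c * cauchyKernel (c * (t - x))) * (M * ‖f t‖) := by
            refine norm_integral_le_of_norm_le (hint.mul_const _) (ae_of_all _ fun x => ?_)
            rw [norm_smul, norm_smul,
              Real.norm_of_nonneg (mul_nonneg hc.le (cauchyKernel_nonneg _))]
            have := cauchyKernel_nonneg (c * (t - x))
            gcongr
            exact hM x
        _ = M * ‖f t‖ := by
            rw [integral_mul_const, integral_scaled_cauchyKernel hc, one_mul]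
    · exact hf.norm.const_mul M
    · refine ae_of_all _ fun t => ?_
      have := tendsto_integral_comp_smul_smul_of_integrable' (μ := volume) (x₀ := t)
        (g := fun x => g x • f t) cauchyKernel_nonneg integral_cauchyKernel
        tendsto_norm_mul_cauchyKernel (hgi.smul_const _)
        (hg.continuous.smul continuous_const).continuousAt
      simpa using this
  -- For c > 1 the points `x ± i/c` lie in the strip `|im| < 1`, so after Fubini the integral over t
  -- is already zero.
  refine tendsto_nhds_unique hlim (tendsto_const_nhds.congr' ?_)
  filter_upwards [eventually_gt_atTop 1] with c hc
  have hc0 : 0 < c := by linarith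
  rw [integral_integral_swap (hprod c hc0)]
  refine (integral_eq_zero_of_ae (ae_of_all _ fun x => ?_)).symm
  have him : |c⁻¹| < 1 := by
    rw [abs_of_pos (by positivity)]; exact inv_lt_one_of_one_lt₀ hc
  have hi (z : ℂ) (hz : z.im ≠ 0) : Integrable (fun t => resolvent z t * f t) μ :=
    hf.bdd_mul (continuous_resolvent hz).aestronglyMeasurable
      (ae_of_all _ (norm_resolvent_le hz))
  have e : ∀ t, (c * cauchyKernel (c * (t - x))) • (g x • f t) =
      ((2 * Real.pi * Complex.I)⁻¹ * g x) * (resolvent (x - (c⁻¹ : ℝ) * Complex.I) t * f t -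
        resolvent (x + (c⁻¹ : ℝ) * Complex.I) t * f t) := by
    intro t
    rw [Complex.real_smul, Complex.real_smul, scaled_cauchyKernel_eq hc0]
    ring
  simp only [e, Pi.zero_apply]
  rw [integral_const_mul, integral_sub, h, h]
  · simp
  · simp [hc0.ne']
  · simpa using him
  · simp [hc0.ne']
  · simpa using him
  · exact hi _ (by simp [hc0.ne'])
  · exact hi _ (by simp [hc0.ne'])

end SecondaryMeasure

/-! ### The operator T on resolvents in complex L². -/

namespace SecondaryMeasure

open Filter Topology ENNReal ComplexConjugate

/-- The Stieltjes transform of a measure. -/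
noncomputable def cauchyTransform (μ : Measure ℝ) (z : ℂ) : ℂ := ∫ t, resolvent z t ∂μ

lemma integrable_resolvent_mul {μ : Measure ℝ} {z : ℂ} (hz : z.im ≠ 0) {f : ℝ → ℂ} (hf : Integrable f μ) :
    Integrable (fun t => resolvent z t * f t) μ :=
  hf.bdd_mul (continuous_resolvent hz).aestronglyMeasurable (ae_of_all _ (norm_resolvent_le hz))

lemma conj_cauchyTransform {μ : Measure ℝ} (z : ℂ) : conj (cauchyTransform μ z) = cauchyTransform μ (conj z) := by
  simp only [cauchyTransform, ← integral_conj, conj_resolvent]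

lemma continuousAt_integral_resolvent_mul {μ : Measure ℝ} {z : ℂ} (hz : z.im ≠ 0) {f : ℝ → ℂ} (hf : Integrable f μ) :
    ContinuousAt (fun w => ∫ t, resolvent w t * f t ∂μ) z := by
  have h0 : 0 < |z.im| := abs_pos.2 hz
  have hev : ∀ᶠ w : ℂ in 𝓝 z, |z.im| / 2 < |w.im| :=
    (Complex.continuous_im.abs.continuousAt (x := z)).eventually_const_lt (by linarith)
  refine continuousAt_of_dominated (bound := fun t => (|z.im| / 2)⁻¹ * ‖f t‖) ?_ ?_
    (hf.norm.const_mul _) (ae_of_all _ fun t => ?_)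
  · filter_upwards [hev] with w hw
    exact (integrable_resolvent_mul (abs_pos.1 (by linarith)) hf).aestronglyMeasurable
  · filter_upwards [hev] with w hw
    refine ae_of_all _ fun t => ?_
    rw [norm_mul]
    gcongr
    exact (norm_resolvent_le (abs_pos.1 (by linarith)) t).trans (inv_anti₀ (by linarith) hw.le)
  · have h1 : ContinuousAt (fun w : ℂ => w - t) z := by fun_prop
    exact (h1.inv₀ (sub_ofReal_ne_zero hz t)).mul continuousAt_const

section

variable {μ : Measure ℝ} [IsProbabilityMeasure μ] {z w : ℂ}

lemma memLp_resolvent (hz : z.im ≠ 0) (p : ℝ≥0∞) : MemLp (resolvent z) p μ :=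
  MemLp.of_bound (continuous_resolvent hz).aestronglyMeasurable _
    (ae_of_all _ (norm_resolvent_le hz))

lemma integrable_resolvent (hz : z.im ≠ 0) : Integrable (resolvent z) μ :=
  memLp_one_iff_integrable.1 (memLp_resolvent hz 1)

lemma integral_resolvent_mul_resolvent (hz : z.im ≠ 0) (hw : w.im ≠ 0) :
    (w - z) * ∫ t, resolvent z t * resolvent w t ∂μ =
      cauchyTransform μ z - cauchyTransform μ w := by
  rw [cauchyTransform, cauchyTransform,
    ← integral_sub (integrable_resolvent hz) (integrable_resolvent hw), ← integral_const_mul]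
  simp only [resolvent_sub hz hw]

/-- A zero at z is also a zero at `conj z`; the two-point identity for this pair would then make the
integral of the positive function `|r_z|²` vanish. -/
lemma cauchyTransform_ne_zero (hz : z.im ≠ 0) : cauchyTransform μ z ≠ 0 := by
  intro h
  have hz' : (conj z).im ≠ 0 := by simpa using hz
  have h1 := integral_resolvent_mul_resolvent (μ := μ) hz hz'
  rw [← conj_cauchyTransform, h, map_zero, sub_zero] at h1
  have hne : conj z - z ≠ 0 := by
    intro h0
    have := congrArg Complex.im h0
    simp at this
    exact hz (by linarith)
  have h2 := (mul_eq_zero.1 h1).resolve_left hne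
  have h3 : ∀ t, resolvent z t * resolvent (conj z) t = ((Complex.normSq (resolvent z t) : ℝ) : ℂ) := by
    intro t
    rw [← conj_resolvent, Complex.mul_conj]
  simp only [h3] at h2
  rw [integral_complex_ofReal, Complex.ofReal_eq_zero] at h2
  have hpos : ∀ t, 0 < Complex.normSq (resolvent z t) := fun t =>
    Complex.normSq_pos.2 (inv_ne_zero (sub_ofReal_ne_zero hz t))
  have hi : Integrable (fun t => Complex.normSq (resolvent z t)) μ := by
    have : Integrable (fun t => (resolvent z t * resolvent (conj z) t).re) μ :=
      (integrable_resolvent_mul hz (integrable_resolvent hz')).re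
    simpa only [h3, Complex.ofReal_re] using this
  rw [integral_eq_zero_iff_of_nonneg (fun t => (hpos t).le) hi] at h2
  obtain ⟨t, ht⟩ := h2.exists
  exact (hpos t).ne' ht

lemma continuousAt_cauchyTransform (hz : z.im ≠ 0) : ContinuousAt (cauchyTransform μ) z := by
  have := continuousAt_integral_resolvent_mul (μ := μ) hz (integrable_const (1 : ℂ))
  simp only [mul_one] at this
  exact this

end

/-- `d • ν` is the secondary measure of `μ`, up to the choice of the constants `c` and `d`. -/
def IsSecondaryPair (μ ν : Measure ℝ) (c d : ℝ) : Prop :=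
  ∀ z : ℂ, z.im ≠ 0 → (d : ℂ) * cauchyTransform ν z = z - c - 1 / cauchyTransform μ z

section

variable {μ ν : Measure ℝ} [IsProbabilityMeasure μ] [IsProbabilityMeasure ν] {c d : ℝ}

/-- Subtracting the secondary relations at z and w eliminates c; the two-point identities turn
differences of transforms into integrals of products. -/
lemma IsSecondaryPair.integral_resolvent_mul_resolvent (h : IsSecondaryPair μ ν c d) {z w : ℂ}
    (hz : z.im ≠ 0) (hw : w.im ≠ 0) :
    d * (cauchyTransform μ z * cauchyTransform μ w * ∫ t, resolvent z t * resolvent w t ∂ν) =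
      ∫ t, resolvent z t * resolvent w t ∂μ - cauchyTransform μ z * cauchyTransform μ w := by
  have main : ∀ {z w : ℂ}, z.im ≠ 0 → w.im ≠ 0 → z ≠ w →
      d * (cauchyTransform μ z * cauchyTransform μ w * ∫ t, resolvent z t * resolvent w t ∂ν) =
      ∫ t, resolvent z t * resolvent w t ∂μ - cauchyTransform μ z * cauchyTransform μ w := by
    intro z w hz hw hne
    have h1 := SecondaryMeasure.integral_resolvent_mul_resolvent (μ := μ) hz hw
    have h2 := SecondaryMeasure.integral_resolvent_mul_resolvent (μ := ν) hz hw
    have h3 := h z hz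
    have h4 := h w hw
    have hSz := cauchyTransform_ne_zero (μ := μ) hz
    have hSw := cauchyTransform_ne_zero (μ := μ) hw
    have hwz : w - z ≠ 0 := sub_ne_zero.2 hne.symm
    have e3 : cauchyTransform μ z * (d * cauchyTransform ν z) =
        cauchyTransform μ z * (z - c) - 1 := by
      rw [h3]; field_simp
    have e4 : cauchyTransform μ w * (d * cauchyTransform ν w) =
        cauchyTransform μ w * (w - c) - 1 := by
      rw [h4]; field_simp
    apply mul_left_cancel₀ hwz
    linear_combination (d * cauchyTransform μ z * cauchyTransform μ w) * h2 - h1 +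
      cauchyTransform μ w * e3 - cauchyTransform μ z * e4
  rcases ne_or_eq z w with hne | rfl
  · exact main hz hw hne
  have hl : ContinuousAt (fun v => d * (cauchyTransform μ v * cauchyTransform μ z *
      ∫ t, resolvent v t * resolvent z t ∂ν)) z :=
    continuousAt_const.mul (((continuousAt_cauchyTransform hz).mul continuousAt_const).mul
      (continuousAt_integral_resolvent_mul hz (integrable_resolvent hz)))
  have hr : ContinuousAt (fun v => ∫ t, resolvent v t * resolvent z t ∂μ -
      cauchyTransform μ v * cauchyTransform μ z) z :=
    (continuousAt_integral_resolvent_mul hz (integrable_resolvent hz)).sub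
      ((continuousAt_cauchyTransform hz).mul continuousAt_const)
  refine tendsto_nhds_unique (hl.tendsto.mono_left (nhdsWithin_le_nhds (s := {z}ᶜ)))
    ((hr.tendsto.mono_left nhdsWithin_le_nhds).congr' ?_)
  have hev : ∀ᶠ v : ℂ in 𝓝[≠] z, v.im ≠ 0 :=
    nhdsWithin_le_nhds (Complex.continuous_im.continuousAt.eventually_ne hz)
  filter_upwards [hev, self_mem_nhdsWithin] with v hv hne
  exact (main hv hz hne).symm

end

/-- The non-real complex numbers. -/
def nonreal : Set ℂ := {z | z.im ≠ 0}

section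

variable (μ : Measure ℝ) [IsProbabilityMeasure μ]

/-- The constant function `1` in `L²(μ)`. -/
noncomputable def oneLp : Lp ℂ 2 μ := (memLp_const (1 : ℂ)).toLp

/-- The function `t ↦ 1 / (z - t)` in `L²(μ)`. -/
noncomputable def resolventLp (z : nonreal) : Lp ℂ 2 μ :=
  (memLp_resolvent z.2 2).toLp

lemma coeFn_oneLp : oneLp μ =ᵐ[μ] fun _ => 1 := MemLp.coeFn_toLp _

lemma coeFn_resolventLp (z : nonreal) : resolventLp μ z =ᵐ[μ] resolvent z := MemLp.coeFn_toLp _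

lemma inner_oneLp (f : Lp ℂ 2 μ) : inner ℂ (oneLp μ) f = ∫ t, f t ∂μ := by
  rw [L2.inner_def]
  refine integral_congr_ae ?_
  filter_upwards [coeFn_oneLp μ] with t ht
  simp [ht]

lemma inner_oneLp_self : inner ℂ (oneLp μ) (oneLp μ) = 1 := by
  rw [inner_oneLp, integral_congr_ae (coeFn_oneLp μ)]
  simp

lemma inner_resolventLp (z : nonreal) (f : Lp ℂ 2 μ) :
    inner ℂ (resolventLp μ z) f = ∫ t, resolvent (conj (z : ℂ)) t * f t ∂μ := by
  rw [L2.inner_def]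
  refine integral_congr_ae ?_
  filter_upwards [coeFn_resolventLp μ z] with t ht
  simp [ht, ← conj_resolvent, mul_comm]

lemma inner_oneLp_resolventLp (z : nonreal) :
    inner ℂ (oneLp μ) (resolventLp μ z) = cauchyTransform μ z := by
  rw [inner_oneLp, integral_congr_ae (coeFn_resolventLp μ z)]
  rfl

lemma inner_resolventLp_resolventLp (z w : nonreal) :
    inner ℂ (resolventLp μ z) (resolventLp μ w) =
      ∫ t, resolvent (conj (z : ℂ)) t * resolvent w t ∂μ := by
  rw [inner_resolventLp]
  refine integral_congr_ae ?_
  filter_upwards [coeFn_resolventLp μ w] with t ht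
  rw [ht]

/-- A function orthogonal to these resolvents has vanishing Stieltjes integrals in the strip, hence
is zero. Restricting to the strip leaves the points with `|im| ≥ 1` free for multiplication by a
distinct resolvent. -/
theorem dense_span_resolventLp :
    Dense ((Submodule.span ℂ (resolventLp μ '' {z | |(z : ℂ).im| < 1}) : Submodule ℂ (Lp ℂ 2 μ)) :
      Set (Lp ℂ 2 μ)) := by
  rw [Submodule.dense_iff_topologicalClosure_eq_top, Submodule.topologicalClosure_eq_top_iff,
    Submodule.eq_bot_iff]
  intro f hf
  rw [Submodule.mem_orthogonal] at hf
  refine (Lp.eq_zero_iff_ae_eq_zero).2 ?_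
  refine ae_eq_zero_of_integral_resolvent_eq_zero ((Lp.memLp f).integrable one_le_two) ?_
  intro z hz hz1
  have hz' : conj z ∈ nonreal := by simpa [nonreal] using hz
  have := hf _ (Submodule.subset_span ⟨⟨conj z, hz'⟩, by simpa using hz1, rfl⟩)
  rw [inner_resolventLp] at this
  simpa using this

theorem denseRange_linearCombination_resolventLp :
    DenseRange (Finsupp.linearCombination ℂ (resolventLp μ)) := by
  refine (dense_span_resolventLp μ).mono ?_
  rw [← LinearMap.coe_range, Finsupp.range_linearCombination]
  exact Submodule.span_mono (Set.image_subset_range _ _)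

end

section

variable {μ ν : Measure ℝ} [IsProbabilityMeasure μ] [IsProbabilityMeasure ν] {c d : ℝ}

/-- `T` sends `1 / (z - t)` to `S(z) / (z - t)`, where `S` is the Stieltjes transform of `μ`. -/
def IsResolventTransform (T : Lp ℂ 2 μ →L[ℂ] Lp ℂ 2 ν) : Prop :=
  ∀ z : nonreal, T (resolventLp μ z) = cauchyTransform μ z • resolventLp ν z

lemma IsSecondaryPair.inner_linearCombination (h : IsSecondaryPair μ ν c d) (e e' : nonreal →₀ ℂ) :
    d * inner ℂ
        (Finsupp.linearCombination ℂ (fun z : nonreal => cauchyTransform μ z • resolventLp ν z) e)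
        (Finsupp.linearCombination ℂ (fun z : nonreal => cauchyTransform μ z • resolventLp ν z) e') =
      inner ℂ (Finsupp.linearCombination ℂ (resolventLp μ) e)
        (Finsupp.linearCombination ℂ (resolventLp μ) e') -
      inner ℂ (Finsupp.linearCombination ℂ (resolventLp μ) e) (oneLp μ) *
        inner ℂ (oneLp μ) (Finsupp.linearCombination ℂ (resolventLp μ) e') := by
  induction e using Finsupp.induction_linear with
  | zero => simp
  | add f g hf hg =>
    simp only [map_add, inner_add_left, mul_add, add_mul, hf, hg]
    ring
  | single z a =>
    induction e' using Finsupp.induction_linear with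
    | zero => simp
    | add f g hf hg =>
      simp only [map_add, inner_add_right, mul_add, hf, hg]
      ring
    | single w b =>
      simp only [Finsupp.linearCombination_single, inner_smul_left, inner_smul_right,
        inner_resolventLp_resolventLp, inner_oneLp_resolventLp,
        ← inner_conj_symm _ (oneLp μ), map_mul, conj_cauchyTransform]
      have hz : (conj (z : ℂ)).im ≠ 0 := by
        rw [Complex.conj_im]; exact neg_ne_zero.2 z.2
      linear_combination (conj a * b) *
        h.integral_resolvent_mul_resolvent hz w.2

/-- The inner product identity with e = e' gives `d‖B e‖² ≤ ‖A e‖²`. This bound makes `A e ↦ B e`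
well defined without linear independence of the resolvents, and continuous. -/
theorem IsSecondaryPair.exists_isResolventTransform (h : IsSecondaryPair μ ν c d) (hd : 0 < d) :
    ∃ T : Lp ℂ 2 μ →L[ℂ] Lp ℂ 2 ν, IsResolventTransform T := by
  set A := Finsupp.linearCombination ℂ (resolventLp μ)
  set B := Finsupp.linearCombination ℂ (fun z : nonreal => cauchyTransform μ z • resolventLp ν z)
  have hbound : ∀ e, ‖B e‖ ≤ (Real.sqrt d)⁻¹ * ‖A e‖ := by
    intro e
    have h1 := h.inner_linearCombination e e
    rw [inner_self_eq_norm_sq_to_K, inner_self_eq_norm_sq_to_K, ← inner_conj_symm _ (oneLp μ),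
      RCLike.conj_mul] at h1
    have h2 : d * ‖B e‖ ^ 2 = ‖A e‖ ^ 2 - ‖inner ℂ (oneLp μ) (A e)‖ ^ 2 := by
      apply Complex.ofReal_injective
      simpa using h1
    have h3 : (Real.sqrt d * ‖B e‖) ^ 2 ≤ ‖A e‖ ^ 2 := by
      rw [mul_pow, Real.sq_sqrt hd.le, h2]
      linarith [sq_nonneg ‖inner ℂ (oneLp μ) (A e)‖]
    have h4 := (pow_le_pow_iff_left₀ (by positivity) (by positivity) two_ne_zero).1 h3
    rw [inv_mul_eq_div, le_div_iff₀ (Real.sqrt_pos.2 hd), mul_comm]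
    exact h4
  refine ⟨B.extendOfNorm A, fun z => ?_⟩
  have := LinearMap.extendOfNorm_eq (denseRange_linearCombination_resolventLp μ) ⟨_, hbound⟩
    (Finsupp.single z 1)
  simpa [A, B] using this

namespace IsResolventTransform

variable {T : Lp ℂ 2 μ →L[ℂ] Lp ℂ 2 ν}

lemma apply_linearCombination (hT : IsResolventTransform T) (e : nonreal →₀ ℂ) :
    T (Finsupp.linearCombination ℂ (resolventLp μ) e) =
      Finsupp.linearCombination ℂ (fun z : nonreal => cauchyTransform μ z • resolventLp ν z) e := by
  simp only [Finsupp.linearCombination_apply, Finsupp.sum, map_sum, map_smul, hT _]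

/-- `T` is, up to the factor `d`, a coisometry whose kernel consists of the constants. -/
theorem inner_apply_apply (hT : IsResolventTransform T) (h : IsSecondaryPair μ ν c d)
    (f g : Lp ℂ 2 μ) :
    d * inner ℂ (T f) (T g) = inner ℂ f g - inner ℂ f (oneLp μ) * inner ℂ (oneLp μ) g := by
  refine (denseRange_linearCombination_resolventLp μ).induction_on₂
    (p := fun f g => d * inner ℂ (T f) (T g) =
      inner ℂ f g - inner ℂ f (oneLp μ) * inner ℂ (oneLp μ) g) ?_ ?_ f g
  · exact isClosed_eq (by fun_prop) (by fun_prop)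
  · intro e e'
    rw [hT.apply_linearCombination, hT.apply_linearCombination, h.inner_linearCombination]

lemma denseRange (hT : IsResolventTransform T) : DenseRange T := by
  have hd := denseRange_linearCombination_resolventLp ν
  refine Dense.mono ?_ hd
  rintro _ ⟨e, rfl⟩
  change _ ∈ (LinearMap.range T.toLinearMap)
  refine Submodule.finsuppSum_mem _ _ _ _ fun z _ => Submodule.smul_mem _ _ ?_
  refine ⟨(cauchyTransform μ z)⁻¹ • resolventLp μ z, ?_⟩
  change T _ = _
  rw [map_smul, hT z, smul_smul, inv_mul_cancel₀ (cauchyTransform_ne_zero z.2),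
    one_smul]

end IsResolventTransform

end

end SecondaryMeasure

/-! ### Multiplication by the variable, and descent to real L². -/

namespace SecondaryMeasure

open Filter Topology ENNReal ComplexConjugate

section

variable (μ : Measure ℝ)

/-- The embedding of the real space `L²(μ)` into the complex one. -/
noncomputable def ofRealLp : Lp ℝ 2 μ →L[ℝ] Lp ℂ 2 μ := Complex.ofRealCLM.compLpL 2 μ

/-- The real part on the complex space `L²(μ)`. -/
noncomputable def reLp : Lp ℂ 2 μ →L[ℝ] Lp ℝ 2 μ := Complex.reCLM.compLpL 2 μ

/-- The imaginary part on the complex space `L²(μ)`. -/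
noncomputable def imLp : Lp ℂ 2 μ →L[ℝ] Lp ℝ 2 μ := Complex.imCLM.compLpL 2 μ

/-- Complex conjugation on `L²(μ)`. -/
noncomputable def conjLp : Lp ℂ 2 μ →L⋆[ℂ] Lp ℂ 2 μ :=
  (starL ℂ : ℂ ≃L⋆[ℂ] ℂ).toContinuousLinearMap.compLpL 2 μ

lemma coeFn_ofRealLp (f : Lp ℝ 2 μ) : ofRealLp μ f =ᵐ[μ] fun t => (f t : ℂ) :=
  ContinuousLinearMap.coeFn_compLpL _ _

lemma coeFn_reLp (f : Lp ℂ 2 μ) : reLp μ f =ᵐ[μ] fun t => (f t).re :=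
  ContinuousLinearMap.coeFn_compLpL _ _

lemma coeFn_imLp (f : Lp ℂ 2 μ) : imLp μ f =ᵐ[μ] fun t => (f t).im :=
  ContinuousLinearMap.coeFn_compLpL _ _

lemma coeFn_conjLp (f : Lp ℂ 2 μ) : conjLp μ f =ᵐ[μ] fun t => conj (f t) :=
  ContinuousLinearMap.coeFn_compLpL _ _

lemma conjLp_ofRealLp (f : Lp ℝ 2 μ) : conjLp μ (ofRealLp μ f) = ofRealLp μ f := by
  apply Lp.ext
  filter_upwards [coeFn_conjLp μ (ofRealLp μ f), coeFn_ofRealLp μ f] with t h1 h2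
  rw [h1, h2, Complex.conj_ofReal]

lemma ofRealLp_reLp_of_conjLp_eq {f : Lp ℂ 2 μ} (hf : conjLp μ f = f) :
    ofRealLp μ (reLp μ f) = f := by
  apply Lp.ext
  have h0 := coeFn_conjLp μ f
  rw [hf] at h0
  filter_upwards [h0, coeFn_ofRealLp μ (reLp μ f), coeFn_reLp μ f] with t h1 h2 h3
  rw [h2, h3]
  exact Complex.conj_eq_iff_re.1 h1.symm

lemma reLp_ofRealLp (f : Lp ℝ 2 μ) : reLp μ (ofRealLp μ f) = f := by
  apply Lp.ext
  filter_upwards [coeFn_reLp μ (ofRealLp μ f), coeFn_ofRealLp μ f] with t h1 h2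
  rw [h1, h2, Complex.ofReal_re]

lemma reLp_I_smul_ofRealLp (f : Lp ℝ 2 μ) : reLp μ (Complex.I • ofRealLp μ f) = 0 := by
  apply Lp.ext
  filter_upwards [coeFn_reLp μ (Complex.I • ofRealLp μ f), coeFn_ofRealLp μ f,
    Lp.coeFn_smul Complex.I (ofRealLp μ f), Lp.coeFn_zero ℝ 2 μ] with t h1 h2 h3 h4
  rw [h1, h3, Pi.smul_apply, h2, h4]
  simp

lemma ofRealLp_reLp_add_I_smul (f : Lp ℂ 2 μ) :
    ofRealLp μ (reLp μ f) + Complex.I • ofRealLp μ (imLp μ f) = f := by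
  apply Lp.ext
  filter_upwards [coeFn_reLp μ f, coeFn_imLp μ f, coeFn_ofRealLp μ (reLp μ f),
    coeFn_ofRealLp μ (imLp μ f), Lp.coeFn_smul Complex.I (ofRealLp μ (imLp μ f)),
    Lp.coeFn_add (ofRealLp μ (reLp μ f)) (Complex.I • ofRealLp μ (imLp μ f))]
    with t h1 h2 h3 h4 h5 h6
  rw [h6, Pi.add_apply, h5, Pi.smul_apply, h3, h4, h1, h2, smul_eq_mul, mul_comm,
    Complex.re_add_im]

lemma integral_ofRealLp (f : Lp ℝ 2 μ) : ∫ t, ofRealLp μ f t ∂μ = ((∫ t, f t ∂μ : ℝ) : ℂ) := by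
  rw [integral_congr_ae (coeFn_ofRealLp μ f), integral_complex_ofReal]

lemma inner_ofRealLp_ofRealLp (f g : Lp ℝ 2 μ) :
    inner ℂ (ofRealLp μ f) (ofRealLp μ g) = ((inner ℝ f g : ℝ) : ℂ) := by
  rw [L2.inner_def, L2.inner_def, ← integral_complex_ofReal]
  refine integral_congr_ae ?_
  filter_upwards [coeFn_ofRealLp μ f, coeFn_ofRealLp μ g] with t h1 h2
  simp [h1, h2]

end

section

variable (μ : Measure ℝ) [IsProbabilityMeasure μ]

/-- Multiplication by `1 / (z - t)` on `L²(μ)`. -/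
noncomputable def mulResolvent (z : nonreal) : Lp ℂ 2 μ →L[ℂ] Lp ℂ 2 μ :=
  (ContinuousLinearMap.mul ℂ ℂ).holderL μ ∞ 2 2 (memLp_resolvent z.2 ∞).toLp

lemma coeFn_mulResolvent (z : nonreal) (f : Lp ℂ 2 μ) :
    mulResolvent μ z f =ᵐ[μ] fun t => resolvent z t * f t := by
  filter_upwards [ContinuousLinearMap.coeFn_holder (r := 2) (ContinuousLinearMap.mul ℂ ℂ)
    (memLp_resolvent z.2 ∞).toLp f, MemLp.coeFn_toLp (memLp_resolvent (μ := μ) z.2 ∞)] with t h1 h2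
  rw [h2] at h1
  exact h1

lemma mulResolvent_resolventLp {z w : nonreal} (h : z ≠ w) :
    mulResolvent μ z (resolventLp μ w) =
      ((z : ℂ) - w)⁻¹ • (resolventLp μ w - resolventLp μ z) := by
  have hne : (z : ℂ) - w ≠ 0 := sub_ne_zero.2 (Subtype.coe_injective.ne h)
  apply Lp.ext
  filter_upwards [coeFn_mulResolvent μ z (resolventLp μ w), coeFn_resolventLp μ z,
    coeFn_resolventLp μ w, Lp.coeFn_smul ((z : ℂ) - w)⁻¹ (resolventLp μ w - resolventLp μ z),
    Lp.coeFn_sub (resolventLp μ w) (resolventLp μ z)] with t h1 h2 h3 h4 h5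
  rw [h1, h4, Pi.smul_apply, h5, Pi.sub_apply, h2, h3, resolvent_sub w.2 z.2, smul_eq_mul]
  field_simp

lemma inner_resolventLp_mul_resolvent {z w : nonreal} (h : z ≠ w) :
    ((z : ℂ) - w) * inner ℂ (oneLp μ) (mulResolvent μ z (resolventLp μ w)) =
      cauchyTransform μ w - cauchyTransform μ z := by
  have hne : (z : ℂ) - w ≠ 0 := sub_ne_zero.2 (Subtype.coe_injective.ne h)
  rw [mulResolvent_resolventLp μ h, inner_smul_right, inner_sub_right, inner_oneLp_resolventLp,
    inner_oneLp_resolventLp, mul_inv_cancel_left₀ hne]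

end

variable {μ ν : Measure ℝ} [IsProbabilityMeasure μ] [IsProbabilityMeasure ν] {c d : ℝ}

namespace IsResolventTransform

variable {T : Lp ℂ 2 μ →L[ℂ] Lp ℂ 2 ν}

/-- T commutes with multiplication by `r_z` up to a rank one operator. Both sides are continuous, so
it suffices to test on `r_w` with w in the strip; then w ≠ z and partial fractions apply. -/
lemma apply_mulResolvent (hT : IsResolventTransform T) {z : nonreal} (hz : 1 ≤ |(z : ℂ).im|)
    (f : Lp ℂ 2 μ) :
    T (mulResolvent μ z f) =
      mulResolvent ν z (T f) + inner ℂ (oneLp μ) (mulResolvent μ z f) • resolventLp ν z := by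
  have key : T.comp (mulResolvent μ z) = (mulResolvent ν z).comp T +
      (((innerSL ℂ (oneLp μ)).comp (mulResolvent μ z)).smulRight (resolventLp ν z)) := by
    refine ContinuousLinearMap.ext_on (dense_span_resolventLp μ) ?_
    rintro _ ⟨w, hw, rfl⟩
    have hne : z ≠ w := by
      rintro rfl
      exact absurd hw (not_lt.2 hz)
    have hne' : (z : ℂ) - w ≠ 0 := sub_ne_zero.2 (Subtype.coe_injective.ne hne)
    have hin : inner ℂ (oneLp μ) (mulResolvent μ z (resolventLp μ w)) =
        ((z : ℂ) - w)⁻¹ * (cauchyTransform μ w - cauchyTransform μ z) := by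
      rw [← inner_resolventLp_mul_resolvent μ hne, inv_mul_cancel_left₀ hne']
    simp only [ContinuousLinearMap.comp_apply, add_apply,
      ContinuousLinearMap.smulRight_apply, innerSL_apply_apply, hin]
    rw [mulResolvent_resolventLp μ hne, map_smul, map_sub, hT, hT, map_smul,
      mulResolvent_resolventLp ν hne]
    module
  exact DFunLike.congr_fun key f

lemma apply_oneLp (hT : IsResolventTransform T) (h : IsSecondaryPair μ ν c d) (hd : 0 < d) :
    T (oneLp μ) = 0 := by
  have := hT.inner_apply_apply h (oneLp μ) (oneLp μ)
  rw [inner_oneLp_self] at this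
  have hd' : (d : ℂ) ≠ 0 := by exact_mod_cast hd.ne'
  simpa [hd', inner_self_eq_zero] using this

/-- Multiplication by t is unbounded, so it is reached through a resolvent: `f = r_z (z f - g)`. The
choice z = i meets the condition `1 ≤ |im z|`. -/
lemma apply_of_ae_eq_mul (hT : IsResolventTransform T) {f g : Lp ℂ 2 μ}
    (hg : g =ᵐ[μ] fun t => t * f t) : T g =ᵐ[ν] fun x => x * T f x + ∫ t, f t ∂μ := by
  set z : nonreal := ⟨Complex.I, by simp [nonreal]⟩
  have hR : mulResolvent μ z ((z : ℂ) • f - g) = f := by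
    apply Lp.ext
    filter_upwards [hg, coeFn_mulResolvent μ z ((z : ℂ) • f - g), Lp.coeFn_sub ((z : ℂ) • f) g,
      Lp.coeFn_smul (z : ℂ) f] with t h1 h2 h3 h4
    rw [h2, h3, Pi.sub_apply, h4, Pi.smul_apply, h1, smul_eq_mul, ← sub_mul, resolvent,
      inv_mul_cancel_left₀ (sub_ofReal_ne_zero z.2 t)]
  have h := hT.apply_mulResolvent (z := z) (by simp [z]) ((z : ℂ) • f - g)
  rw [hR, inner_oneLp, map_sub, map_smul] at h
  set a := ∫ t, f t ∂μ
  have h0 : T f =ᵐ[ν] (mulResolvent ν z ((z : ℂ) • T f - T g) + a • resolventLp ν z : Lp ℂ 2 ν) := by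
    rw [← h]
  filter_upwards [h0, coeFn_mulResolvent ν z ((z : ℂ) • T f - T g),
    Lp.coeFn_sub ((z : ℂ) • T f) (T g), Lp.coeFn_smul (z : ℂ) (T f),
    Lp.coeFn_add (mulResolvent ν z ((z : ℂ) • T f - T g)) (a • resolventLp ν z),
    Lp.coeFn_smul a (resolventLp ν z), coeFn_resolventLp ν z] with x h1 h2 h3 h4 h5 h6 h7
  rw [h5, Pi.add_apply, h2, h3, Pi.sub_apply, h4, Pi.smul_apply, h6, Pi.smul_apply, h7,
    smul_eq_mul, smul_eq_mul, resolvent] at h1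
  have hne := sub_ofReal_ne_zero z.2 x
  have h8 : ((z : ℂ) - x) * T f x = z * T f x - T g x + a := by
    conv_lhs => rw [h1]
    field_simp
  linear_combination h8

/-- This reality property, due to `S(conj z) = conj S(z)`, is what lets T restrict to the real
spaces. -/
lemma conjLp_apply (hT : IsResolventTransform T) (f : Lp ℂ 2 μ) :
    conjLp ν (T f) = T (conjLp μ f) := by
  have hconj (μ : Measure ℝ) [IsProbabilityMeasure μ] (z : nonreal) :
      ∃ w : nonreal, (w : ℂ) = conj (z : ℂ) ∧ conjLp μ (resolventLp μ z) = resolventLp μ w := by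
    have hz : conj (z : ℂ) ∈ nonreal := by
      change (conj (z : ℂ)).im ≠ 0
      rw [Complex.conj_im]
      exact neg_ne_zero.2 z.2
    refine ⟨⟨conj (z : ℂ), hz⟩, rfl, ?_⟩
    apply Lp.ext
    filter_upwards [coeFn_conjLp μ (resolventLp μ z), coeFn_resolventLp μ z,
      coeFn_resolventLp μ ⟨conj (z : ℂ), hz⟩] with t h1 h2 h3
    rw [h1, h2, h3, conj_resolvent]
  have key : (conjLp ν).comp T = T.comp (conjLp μ) := by
    refine ContinuousLinearMap.ext_on (dense_span_resolventLp μ) ?_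
    rintro _ ⟨z, -, rfl⟩
    obtain ⟨w, hw, h1⟩ := hconj μ z
    obtain ⟨w', hw', h2⟩ := hconj ν z
    obtain rfl : w = w' := Subtype.ext (hw.trans hw'.symm)
    rw [ContinuousLinearMap.comp_apply, ContinuousLinearMap.comp_apply, h1, hT, hT,
      ContinuousLinearMap.map_smulₛₗ, h2, hw, conj_cauchyTransform]
  exact DFunLike.congr_fun key f

end IsResolventTransform

/-- The properties that characterise the operator `T_μ` on the real space `L²(μ)`. -/
structure IsSecondaryOperator (d : ℝ) (T : Lp ℝ 2 μ →L[ℝ] Lp ℝ 2 ν) : Prop where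
  apply_const : ∀ (a : ℝ) (f : Lp ℝ 2 μ), f =ᵐ[μ] (fun _ => a) → T f = 0
  apply_of_ae_eq_mul : ∀ f g : Lp ℝ 2 μ, g =ᵐ[μ] (fun t => t * f t) →
    T g =ᵐ[ν] fun x => x * T f x + ∫ t, f t ∂μ
  inner_apply_apply : ∀ f g : Lp ℝ 2 μ,
    d * inner ℝ (T f) (T g) = inner ℝ f g - (∫ t, f t ∂μ) * ∫ t, g t ∂μ
  denseRange : DenseRange T

theorem IsSecondaryPair.exists_isSecondaryOperator (h : IsSecondaryPair μ ν c d) (hd : 0 < d) :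
    ∃ T : Lp ℝ 2 μ →L[ℝ] Lp ℝ 2 ν, IsSecondaryOperator d T := by
  obtain ⟨T, hT⟩ := h.exists_isResolventTransform hd
  set S : Lp ℝ 2 μ →L[ℝ] Lp ℝ 2 ν :=
    (reLp ν).comp ((T.restrictScalars ℝ).comp (ofRealLp μ)) with hS
  have hSapp : ∀ f, S f = reLp ν (T (ofRealLp μ f)) := fun f => rfl
  have hreal : ∀ f, ofRealLp ν (S f) = T (ofRealLp μ f) := by
    intro f
    rw [hSapp]
    apply ofRealLp_reLp_of_conjLp_eq
    rw [hT.conjLp_apply, conjLp_ofRealLp]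
  refine ⟨S, ?_, ?_, ?_, ?_⟩
  · intro a f hf
    have : ofRealLp μ f = (a : ℂ) • oneLp μ := by
      apply Lp.ext
      filter_upwards [hf, coeFn_ofRealLp μ f, Lp.coeFn_smul (a : ℂ) (oneLp μ), coeFn_oneLp μ]
        with t h1 h2 h3 h4
      rw [h2, h1, h3, Pi.smul_apply, h4]
      simp
    rw [hSapp, this, map_smul, hT.apply_oneLp h hd, smul_zero, map_zero]
  · intro f g hg
    have h1 : ofRealLp μ g =ᵐ[μ] fun t => t * ofRealLp μ f t := by
      filter_upwards [hg, coeFn_ofRealLp μ f, coeFn_ofRealLp μ g] with t h1 h2 h3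
      rw [h3, h1, h2, Complex.ofReal_mul]
    have h2 := hT.apply_of_ae_eq_mul h1
    rw [← hreal, ← hreal, integral_ofRealLp] at h2
    filter_upwards [h2, coeFn_ofRealLp ν (S f), coeFn_ofRealLp ν (S g)] with x h3 h4 h5
    rw [h4, h5] at h3
    exact_mod_cast h3
  · intro f g
    have h1 := hT.inner_apply_apply h (ofRealLp μ f) (ofRealLp μ g)
    rw [← hreal, ← hreal, inner_ofRealLp_ofRealLp, inner_ofRealLp_ofRealLp,
      ← inner_conj_symm (ofRealLp μ f) (oneLp μ),
      inner_oneLp, inner_oneLp, integral_ofRealLp, integral_ofRealLp, Complex.conj_ofReal] at h1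
    exact_mod_cast h1
  -- Real parts of a dense set are dense, and `re (T f) = S (re f)`.
  · have hsurj : Function.Surjective (reLp ν) := fun f => ⟨_, reLp_ofRealLp ν f⟩
    have hd' := hsurj.denseRange.comp hT.denseRange (reLp ν).continuous
    refine Dense.mono ?_ hd'
    rintro _ ⟨f, rfl⟩
    refine ⟨reLp μ f, ?_⟩
    have h1 : T f = ofRealLp ν (S (reLp μ f)) + Complex.I • ofRealLp ν (S (imLp μ f)) := by
      conv_lhs => rw [← ofRealLp_reLp_add_I_smul μ f, map_add, map_smul, ← hreal, ← hreal]
    rw [Function.comp_apply, h1, map_add, reLp_I_smul_ofRealLp, add_zero, reLp_ofRealLp]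

end SecondaryMeasure

/-! ### Action on polynomials and loss of one degree of orthogonality. -/

namespace SecondaryMeasure

open Filter Topology ENNReal Polynomial

/-- Polynomials belong to `L²(μ)`. -/
def HasMoments (μ : Measure ℝ) : Prop := ∀ p : ℝ[X], MemLp (fun x => p.eval x) 2 μ

lemma HasMoments.of_pow {μ : Measure ℝ} (h : ∀ n : ℕ, MemLp (fun x : ℝ => x ^ n) 2 μ) :
    HasMoments μ := by
  intro p
  simp only [Polynomial.eval_eq_sum_range]
  exact memLp_finsetSum _ fun i _ => (h i).const_mul _

lemma HasMoments.integrable {μ : Measure ℝ} [IsFiniteMeasure μ] (h : HasMoments μ) (p : ℝ[X]) :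
    Integrable (fun x => p.eval x) μ :=
  (h p).integrable one_le_two

/-- The elements of `L²(μ)` represented by polynomials. -/
def polynomialSubmodule (μ : Measure ℝ) : Submodule ℝ (Lp ℝ 2 μ) where
  carrier := {h | ∃ p : ℝ[X], h =ᵐ[μ] fun x => p.eval x}
  zero_mem' := ⟨0, by filter_upwards [Lp.coeFn_zero ℝ 2 μ] with x hx; rw [eval_zero]; exact hx⟩
  add_mem' := by
    rintro f g ⟨p, hp⟩ ⟨q, hq⟩
    refine ⟨p + q, ?_⟩
    filter_upwards [hp, hq, Lp.coeFn_add f g] with x h1 h2 h3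
    rw [h3, Pi.add_apply, h1, h2, eval_add]
  smul_mem' := by
    rintro a f ⟨p, hp⟩
    refine ⟨C a * p, ?_⟩
    filter_upwards [hp, Lp.coeFn_smul a f] with x h1 h2
    rw [h2, Pi.smul_apply, h1, eval_mul, eval_C, smul_eq_mul]

/-- Polynomials form a dense subspace of `L²(μ)`. -/
structure IsPolynomialDense (μ : Measure ℝ) : Prop where
  hasMoments : HasMoments μ
  dense : Dense (polynomialSubmodule μ : Set (Lp ℝ 2 μ))

/-- Monomials are images under `T` of polynomials of degree one more. -/
theorem IsSecondaryOperator.exists_preimage_pow {μ ν : Measure ℝ} [IsProbabilityMeasure μ]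
    {d : ℝ} {T : Lp ℝ 2 μ →L[ℝ] Lp ℝ 2 ν} (hT : IsSecondaryOperator d T) (hm : HasMoments μ) (j : ℕ) :
    ∃ (p : ℝ[X]) (h : Lp ℝ 2 μ), p.natDegree ≤ j + 1 ∧ h =ᵐ[μ] (fun x => p.eval x) ∧
      T h =ᵐ[ν] fun x => x ^ j := by
  have eX := MemLp.coeFn_toLp (hm X)
  have e1 := MemLp.coeFn_toLp (hm 1)
  have hX : T (hm X).toLp =ᵐ[ν] fun _ => 1 := by
    have h1 := hT.apply_of_ae_eq_mul (hm 1).toLp (hm X).toLp (by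
      filter_upwards [eX, e1] with t h1 h2
      rw [h1, h2]
      simp)
    rw [hT.apply_const 1 (hm 1).toLp (by simpa using e1)] at h1
    filter_upwards [h1, Lp.coeFn_zero ℝ 2 ν] with x h2 h3
    rw [h2, h3, integral_congr_ae e1]
    simp
  induction j with
  | zero => exact ⟨X, (hm X).toLp, by simp, eX, by simpa using hX⟩
  | succ j ih =>
    obtain ⟨p, h, hdeg, hp, hTp⟩ := ih
    have e2 := MemLp.coeFn_toLp (hm (X * p))
    set a := ∫ t, h t ∂μ
    -- `T(X p)` is `x ^ (j + 1) + a`; since `T X = 1`, subtracting `a X` removes the constant.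
    refine ⟨X * p - C a * X, (hm (X * p)).toLp - a • (hm X).toLp, ?_, ?_, ?_⟩
    · refine (natDegree_sub_le _ _).trans (max_le ?_ ?_)
      · refine natDegree_mul_le.trans ?_
        rw [natDegree_X]; omega
      · exact (natDegree_C_mul_le _ _).trans (by rw [natDegree_X]; omega)
    · filter_upwards [e2, eX, Lp.coeFn_sub (hm (X * p)).toLp (a • (hm X).toLp),
        Lp.coeFn_smul a (hm X).toLp] with t h1 h2 h3 h4
      rw [h3, Pi.sub_apply, h4, Pi.smul_apply, h1, h2]
      simp
    · rw [map_sub, map_smul]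
      have h5 := hT.apply_of_ae_eq_mul h (hm (X * p)).toLp (by
        filter_upwards [e2, hp] with t h1 h2
        rw [h1, h2]
        simp)
      filter_upwards [h5, hX, hTp, Lp.coeFn_sub (T (hm (X * p)).toLp) (a • T (hm X).toLp),
        Lp.coeFn_smul a (T (hm X).toLp)] with x h1 h2 h3 h4 h6
      rw [h4, Pi.sub_apply, h6, Pi.smul_apply, h1, h2, h3, smul_eq_mul]
      ring

section

variable {μ : Measure ℝ} [IsProbabilityMeasure μ] [NullSingletonClass μ]

lemma integrable_slope (hm : HasMoments μ) (p : ℝ[X]) (x : ℝ) :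
    Integrable (fun t => (p.eval t - p.eval x) / (t - x)) μ := by
  obtain ⟨r, hr⟩ := Polynomial.X_sub_C_dvd_sub_C_eval (a := x) (p := p)
  refine (hm.integrable r).congr ?_
  filter_upwards [Measure.ae_ne μ x] with t ht
  have h1 := congrArg (fun q => q.eval t) hr
  simp only [eval_sub, eval_C, eval_mul, eval_X] at h1
  rw [h1, mul_div_cancel_left₀ _ (sub_ne_zero.2 ht)]

/-- This is the recursion satisfied by T, so the integral operator and T agree by induction on the
degree. The point t = x, where the quotient is 0 by convention, is null. -/
lemma integral_slope_X_mul (hm : HasMoments μ) (p : ℝ[X]) (x : ℝ) :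
    ∫ t, ((X * p).eval t - (X * p).eval x) / (t - x) ∂μ =
      x * ∫ t, (p.eval t - p.eval x) / (t - x) ∂μ + ∫ t, p.eval t ∂μ := by
  rw [← integral_const_mul, ← integral_add ((integrable_slope hm p x).const_mul x) (hm.integrable p)]
  refine integral_congr_ae ?_
  filter_upwards [Measure.ae_ne μ x] with t ht
  have : t - x ≠ 0 := sub_ne_zero.2 ht
  simp only [eval_mul, eval_X]
  field_simp
  ring

variable {ν : Measure ℝ} {d : ℝ} {T : Lp ℝ 2 μ →L[ℝ] Lp ℝ 2 ν}

namespace IsSecondaryOperator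

/-- On polynomials, `T` acts by an integral formula, and its values are polynomials. -/
theorem exists_secondary_polynomial (hT : IsSecondaryOperator d T) (hm : HasMoments μ)
    (p : ℝ[X]) : ∃ q : ℝ[X],
      (∀ h : Lp ℝ 2 μ, h =ᵐ[μ] (fun x => p.eval x) → T h =ᵐ[ν] fun x => q.eval x) ∧
      ∀ x, ∫ t, (p.eval t - p.eval x) / (t - x) ∂μ = q.eval x := by
  induction p using Polynomial.induction_on with
  | C a =>
    refine ⟨0, fun h hh => ?_, fun x => by simp⟩
    rw [hT.apply_const a h (by simpa using hh)]
    filter_upwards [Lp.coeFn_zero ℝ 2 ν] with x hx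
    rw [eval_zero]
    exact hx
  | add p q hp hq =>
    obtain ⟨p', hp1, hp2⟩ := hp
    obtain ⟨q', hq1, hq2⟩ := hq
    refine ⟨p' + q', fun h hh => ?_, fun x => ?_⟩
    · have e1 := MemLp.coeFn_toLp (hm p)
      have e2 := MemLp.coeFn_toLp (hm q)
      have e : h = (hm p).toLp + (hm q).toLp := by
        apply Lp.ext
        filter_upwards [hh, e1, e2, Lp.coeFn_add (hm p).toLp (hm q).toLp] with x h1 h2 h3 h4
        rw [h1, h4, Pi.add_apply, h2, h3, eval_add]
      rw [e, map_add]
      filter_upwards [hp1 _ e1, hq1 _ e2, Lp.coeFn_add (T (hm p).toLp) (T (hm q).toLp)]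
        with x h1 h2 h3
      rw [h3, Pi.add_apply, h1, h2, eval_add]
    · rw [show (p' + q').eval x = p'.eval x + q'.eval x from eval_add, ← hp2, ← hq2,
        ← integral_add (integrable_slope hm p x) (integrable_slope hm q x)]
      refine integral_congr_ae (ae_of_all _ fun t => ?_)
      simp only [eval_add]
      ring
  | monomial n a ih =>
    obtain ⟨q, h1, h2⟩ := ih
    set p : ℝ[X] := C a * X ^ n with hp
    have e : (C a * X ^ (n + 1) : ℝ[X]) = X * p := by rw [hp]; ring
    rw [e]
    refine ⟨X * q + C (∫ t, p.eval t ∂μ), fun h hh => ?_, fun x => ?_⟩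
    · have e1 := MemLp.coeFn_toLp (hm p)
      have := hT.apply_of_ae_eq_mul (hm p).toLp h (by
        filter_upwards [hh, e1] with t h3 h4
        rw [h3, h4, eval_mul, eval_X])
      filter_upwards [this, h1 _ e1] with x h3 h4
      rw [h3, h4, integral_congr_ae e1]
      simp
    · rw [integral_slope_X_mul hm, h2]
      simp

/-- Monomials are values of T, hence square integrable for ν; density survives because T is
continuous with dense range and sends polynomials to polynomials. -/
theorem isPolynomialDense (hT : IsSecondaryOperator d T) (hμ : IsPolynomialDense μ) :
    IsPolynomialDense ν where
  hasMoments := HasMoments.of_pow fun j => by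
    obtain ⟨p, h, -, -, hTp⟩ := hT.exists_preimage_pow hμ.hasMoments j
    exact (memLp_congr_ae hTp).1 (Lp.memLp (T h))
  dense := by
    refine (hT.denseRange.dense_image T.continuous hμ.dense).mono ?_
    rintro _ ⟨h, ⟨p, hp⟩, rfl⟩
    obtain ⟨q, hq, -⟩ := hT.exists_secondary_polynomial hμ.hasMoments p
    exact ⟨q, hq h hp⟩

end IsSecondaryOperator

end

/-- Zero variance would concentrate μ at its mean, which is a null point. -/
lemma variance_pos {μ : Measure ℝ} [IsProbabilityMeasure μ] [NullSingletonClass μ]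
    (hm : HasMoments μ) : 0 < (∫ x, x ^ 2 ∂μ) - (∫ x, x ∂μ) ^ 2 := by
  have h1 : Integrable (fun x : ℝ => x) μ := by simpa using hm.integrable X
  have h2 : Integrable (fun x : ℝ => x ^ 2) μ := by
    simpa only [eval_pow, eval_X] using hm.integrable (X ^ (2 : ℕ))
  obtain ⟨a, ha⟩ : ∃ a, a = ∫ x, x ∂μ := ⟨_, rfl⟩
  have h3 : Integrable (fun x => (x - a) ^ 2) μ := by
    have := hm.integrable ((X - C a) ^ (2 : ℕ))
    simpa only [eval_pow, eval_sub, eval_X, eval_C] using this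
  have h4 : (∫ x, x ^ 2 ∂μ) - (∫ x, x ∂μ) ^ 2 = ∫ x, (x - a) ^ 2 ∂μ := by
    have e : ∀ x : ℝ, (x - a) ^ 2 = x ^ 2 - (2 * a) * x + a ^ 2 := fun x => by ring
    simp only [e]
    have h5 : Integrable (fun x => x ^ 2 - (2 * a) * x) μ := h2.sub (h1.const_mul _)
    rw [integral_add h5 (integrable_const _),
      integral_sub h2 (h1.const_mul _), integral_const_mul, ← ha, integral_const]
    simp only [probReal_univ, one_smul]
    ring
  rw [h4]
  refine lt_of_le_of_ne (integral_nonneg fun x => sq_nonneg _) fun h5 => ?_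
  rw [eq_comm, integral_eq_zero_iff_of_nonneg (fun x => sq_nonneg _) h3] at h5
  obtain ⟨x, hx, hx'⟩ := (h5.and (Measure.ae_ne μ a)).exists
  exact hx' (sub_eq_zero.1 ((pow_eq_zero_iff two_ne_zero).1 hx))

/-- `g` is orthogonal in `L²(μ)` to the monomials of degree at most `n`. -/
def IsOrthogonalUpTo (μ : Measure ℝ) (n : ℕ) (g : Lp ℝ 2 μ) : Prop :=
  ∀ j ≤ n, ∫ t, t ^ j * g t ∂μ = 0

lemma inner_eq_integral_mul {μ : Measure ℝ} {h g : Lp ℝ 2 μ} {u : ℝ → ℝ} (hu : h =ᵐ[μ] u) :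
    inner ℝ h g = ∫ t, u t * g t ∂μ := by
  rw [L2.inner_def]
  refine integral_congr_ae ?_
  filter_upwards [hu] with t ht
  simp [ht, mul_comm]

lemma IsOrthogonalUpTo.integral_eq_zero {μ : Measure ℝ} {n : ℕ} {g : Lp ℝ 2 μ}
    (hg : IsOrthogonalUpTo μ n g) : ∫ t, g t ∂μ = 0 := by
  simpa using hg 0 n.zero_le

lemma IsOrthogonalUpTo.integral_eval_mul {μ : Measure ℝ} (hm : HasMoments μ) {n : ℕ}
    {g : Lp ℝ 2 μ} (hg : IsOrthogonalUpTo μ n g) {p : ℝ[X]} (hp : p.natDegree ≤ n) :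
    ∫ t, p.eval t * g t ∂μ = 0 := by
  have hpow (i : ℕ) : MemLp (fun t : ℝ => t ^ i) 2 μ := by simpa using hm (X ^ i)
  simp only [Polynomial.eval_eq_sum_range, Finset.sum_mul, mul_assoc]
  have hi (i : ℕ) : Integrable (fun t => p.coeff i * (t ^ i * g t)) μ :=
    ((hpow i).integrable_mul (Lp.memLp g)).const_mul _
  rw [integral_finsetSum _ fun i _ => hi i]
  refine Finset.sum_eq_zero fun i hi => ?_
  rw [integral_const_mul, hg i (by have := Finset.mem_range.1 hi; omega), mul_zero]

/-- `x ^ j` is `T h` with h of degree at most j + 1, and since g has mean zero, `d⟨T h, T g⟩ = ⟨h,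
g⟩ = 0`. -/
lemma IsSecondaryOperator.isOrthogonalUpTo {μ ν : Measure ℝ} [IsProbabilityMeasure μ] [NullSingletonClass μ]
    [IsProbabilityMeasure ν] {d : ℝ} {T : Lp ℝ 2 μ →L[ℝ] Lp ℝ 2 ν}
    (hT : IsSecondaryOperator d T) (hd : d ≠ 0) (hm : HasMoments μ) {n : ℕ} {g : Lp ℝ 2 μ}
    (hg : IsOrthogonalUpTo μ (n + 1) g) : IsOrthogonalUpTo ν n (T g) := by
  intro j hj
  obtain ⟨p, h, hdeg, hp, hTp⟩ := hT.exists_preimage_pow hm j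
  have h1 := hT.inner_apply_apply h g
  rw [hg.integral_eq_zero, mul_zero, sub_zero, inner_eq_integral_mul hp,
    hg.integral_eval_mul hm (by omega)] at h1
  rw [← inner_eq_integral_mul hTp]
  exact (mul_eq_zero.1 h1).resolve_left hd

/-- Eliminating the top coefficient with `P n` reduces the degree. It serves to pass from the `P k`
to all polynomials, both for square integrability and for orthogonality. -/
lemma mem_of_degree_lt {P : ℕ → ℝ[X]} (hdeg : ∀ k : ℕ, (P k).degree = (k : WithBot ℕ))
    (W : Submodule ℝ ℝ[X]) (n : ℕ) (hW : ∀ k < n, P k ∈ W) (p : ℝ[X])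
    (hp : p.degree < (n : WithBot ℕ)) : p ∈ W := by
  induction n generalizing p with
  | zero =>
    have : p = 0 := by
      rw [degree_lt_iff_coeff_zero] at hp
      ext m
      simpa using hp m m.zero_le
    simp [this]
  | succ n ih =>
    have hne : (P n).coeff n ≠ 0 := by
      intro h0
      have h1 : (P n).leadingCoeff = 0 := by
        rw [leadingCoeff, natDegree_eq_of_degree_eq_some (hdeg n), h0]
      have h2 := hdeg n
      rw [leadingCoeff_eq_zero.1 h1, degree_zero] at h2
      exact WithBot.bot_ne_coe h2
    have hq := ih (fun k hk => hW k (by omega)) (p - (p.coeff n / (P n).coeff n) • P n) (by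
      rw [degree_lt_iff_coeff_zero] at hp ⊢
      intro m hm
      rcases hm.eq_or_lt with rfl | hlt
      · rw [coeff_sub, coeff_smul, smul_eq_mul, div_mul_cancel₀ _ hne, sub_self]
      · have h3 : (P n).coeff m = 0 :=
          coeff_eq_zero_of_degree_lt (by rw [hdeg n]; exact_mod_cast hlt)
        rw [coeff_sub, coeff_smul, h3, hp m hlt]
        simp)
    have := W.add_mem hq (W.smul_mem (p.coeff n / (P n).coeff n) (hW n n.lt_succ_self))
    simpa using this

end SecondaryMeasure

/-! ### Translation to densities, and iteration. -/

namespace SecondaryMeasure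

open Filter Topology ENNReal Polynomial

section

variable {I : Set ℝ} {ρ ρ' : ℝ → ℝ}

lemma IsProbDensity.aemeasurable (hρ : IsProbDensity I ρ) :
    AEMeasurable (fun x => ENNReal.ofReal (ρ x)) (volume.restrict I) :=
  hρ.integrable.aestronglyMeasurable.aemeasurable.ennreal_ofReal

lemma IsProbDensity.ae_nonneg (hρ : IsProbDensity I ρ) (hI : MeasurableSet I) :
    ∀ᵐ x ∂volume.restrict I, 0 ≤ ρ x := by
  filter_upwards [ae_restrict_mem hI] with x hx using hρ.nonneg x hx

lemma IsProbDensity.isProbabilityMeasure (hρ : IsProbDensity I ρ) (hI : MeasurableSet I) :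
    IsProbabilityMeasure (densMeasure I ρ) := by
  refine ⟨?_⟩
  rw [densMeasure, withDensity_apply _ MeasurableSet.univ, Measure.restrict_univ,
    ← ofReal_integral_eq_lintegral_ofReal hρ.integrable (hρ.ae_nonneg hI), hρ.integral_eq_one,
    ENNReal.ofReal_one]

instance nullSingletonClass_densMeasure : NullSingletonClass (densMeasure I ρ) :=
  ⟨fun x => (withDensity_absolutelyContinuous _ _) (measure_singleton x)⟩

lemma IsProbDensity.integral_densMeasure (hρ : IsProbDensity I ρ) (hI : MeasurableSet I)
    {E : Type*} [NormedAddCommGroup E] [NormedSpace ℝ E] (f : ℝ → E) :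
    ∫ x, f x ∂(densMeasure I ρ) = ∫ x in I, ρ x • f x := by
  rw [densMeasure, integral_withDensity_eq_integral_toReal_smul₀ hρ.aemeasurable
    (ae_of_all _ fun x => ENNReal.ofReal_lt_top)]
  refine integral_congr_ae ?_
  filter_upwards [hρ.ae_nonneg hI] with x hx
  rw [ENNReal.toReal_ofReal hx]

lemma IsProbDensity.stieltjes_eq_cauchyTransform (hρ : IsProbDensity I ρ) (hI : MeasurableSet I)
    (z : ℂ) : stieltjes I ρ z = cauchyTransform (densMeasure I ρ) z := by
  rw [cauchyTransform, hρ.integral_densMeasure hI, stieltjes]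
  simp only [resolvent, Complex.real_smul, div_eq_mul_inv]

lemma IsNormalizedSecondary.isSecondaryPair (h : IsNormalizedSecondary I ρ ρ')
    (hρ : IsProbDensity I ρ) (hI : MeasurableSet I) :
    IsSecondaryPair (densMeasure I ρ) (densMeasure I ρ') (c₁ I ρ) (d₀ I ρ) := by
  intro z hz
  rw [← hρ.stieltjes_eq_cauchyTransform hI, ← h.isProbDensity.stieltjes_eq_cauchyTransform hI]
  refine h.stieltjes_eq z ?_
  rintro ⟨x, -, rfl⟩
  exact hz (Complex.ofReal_im x)

lemma IsProbDensity.d₀_pos (hρ : IsProbDensity I ρ) (hI : MeasurableSet I)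
    (hm : HasMoments (densMeasure I ρ)) : 0 < d₀ I ρ := by
  have := hρ.isProbabilityMeasure hI
  have hc₁ : c₁ I ρ = ∫ x, x ∂(densMeasure I ρ) := by
    rw [hρ.integral_densMeasure hI, c₁]
    simp only [smul_eq_mul, mul_comm]
  have hc₂ : c₂ I ρ = ∫ x, x ^ 2 ∂(densMeasure I ρ) := by
    rw [hρ.integral_densMeasure hI, c₂]
    simp only [smul_eq_mul, mul_comm]
  rw [d₀, hc₁, hc₂]
  exact variance_pos hm

lemma IsProbDensity.secondaryIntegral_eq (hρ : IsProbDensity I ρ) (hI : MeasurableSet I)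
    (h : ℝ → ℝ) (x : ℝ) :
    secondaryIntegral I ρ h x = ∫ t, (h t - h x) / (t - x) ∂(densMeasure I ρ) := by
  rw [hρ.integral_densMeasure hI, secondaryIntegral]
  simp only [smul_eq_mul, mul_comm]

lemma IsSecondaryTransform.unique (hμ : IsPolynomialDense (densMeasure I ρ))
    {T T' : L2 I ρ →L[ℝ] L2 I ρ'}
    (hT : IsSecondaryTransform I ρ ρ' T) (hT' : IsSecondaryTransform I ρ ρ' T') : T = T' := by
  refine ContinuousLinearMap.ext_on (s := polynomialSubmodule (densMeasure I ρ)) ?_ ?_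
  · rw [Submodule.span_eq]
    exact hμ.dense
  · rintro h ⟨p, hp⟩
    exact Lp.ext ((hT p h hp).trans (hT' p h hp).symm)

/-- Existence, uniqueness and properties of the operator attached to a normalized secondary
density, when polynomials are dense. -/
theorem IsNormalizedSecondary.exists_transform (h : IsNormalizedSecondary I ρ ρ')
    (hρ : IsProbDensity I ρ) (hI : MeasurableSet I) (hμ : IsPolynomialDense (densMeasure I ρ))
    [IsProbabilityMeasure (densMeasure I ρ)] [IsProbabilityMeasure (densMeasure I ρ')] :
    ∃ T : L2 I ρ →L[ℝ] L2 I ρ', IsSecondaryTransform I ρ ρ' T ∧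
      IsSecondaryOperator (μ := densMeasure I ρ) (ν := densMeasure I ρ') (d₀ I ρ) T := by
  obtain ⟨T, hT⟩ :=
    (h.isSecondaryPair hρ hI).exists_isSecondaryOperator (hρ.d₀_pos hI hμ.hasMoments)
  refine ⟨T, fun p f hf => ?_, hT⟩
  obtain ⟨q, hq1, hq2⟩ := hT.exists_secondary_polynomial hμ.hasMoments p
  filter_upwards [hq1 f hf] with x hx
  rw [hx, hρ.secondaryIntegral_eq hI, hq2]

theorem IsNormalizedSecondary.existsUnique_transform (h : IsNormalizedSecondary I ρ ρ')
    (hρ : IsProbDensity I ρ) (hI : MeasurableSet I) (hμ : IsPolynomialDense (densMeasure I ρ)) :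
    ∃! T : L2 I ρ →L[ℝ] L2 I ρ', IsSecondaryTransform I ρ ρ' T := by
  have := hρ.isProbabilityMeasure hI
  have := h.isProbDensity.isProbabilityMeasure hI
  obtain ⟨T, hT, -⟩ := h.exists_transform hρ hI hμ
  exact ⟨T, hT, fun T' hT' => hT'.unique hμ hT⟩

theorem IsNormalizedSecondary.isSecondaryOperator_secondaryTransform
    (h : IsNormalizedSecondary I ρ ρ')
    (hρ : IsProbDensity I ρ) (hI : MeasurableSet I) (hμ : IsPolynomialDense (densMeasure I ρ))
    [IsProbabilityMeasure (densMeasure I ρ)] [IsProbabilityMeasure (densMeasure I ρ')] :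
    IsSecondaryOperator (μ := densMeasure I ρ) (ν := densMeasure I ρ') (d₀ I ρ)
      (secondaryTransform I ρ ρ') := by
  obtain ⟨T, hT, hT'⟩ := h.exists_transform hρ hI hμ
  have hex : ∃ T : L2 I ρ →L[ℝ] L2 I ρ', IsSecondaryTransform I ρ ρ' T := ⟨T, hT⟩
  have e : secondaryTransform I ρ ρ' = T := by
    rw [secondaryTransform, dif_pos hex]
    exact hex.choose_spec.unique hμ hT
  rwa [e]

end

section

variable {I : Set ℝ} {ρ : ℕ → ℝ → ℝ}

lemma isProbDensity_of_isNormalizedSecondary (hρ : IsProbDensity I (ρ 0))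
    (hsec : ∀ k : ℕ, IsNormalizedSecondary I (ρ k) (ρ (k + 1))) : ∀ k, IsProbDensity I (ρ k)
  | 0 => hρ
  | k + 1 => (hsec k).isProbDensity

lemma isPolynomialDense_of_isNormalizedSecondary (hI : MeasurableSet I)
    (hρ : IsProbDensity I (ρ 0))
    (hsec : ∀ k : ℕ, IsNormalizedSecondary I (ρ k) (ρ (k + 1)))
    (h0 : IsPolynomialDense (densMeasure I (ρ 0))) (k : ℕ) :
    IsPolynomialDense (densMeasure I (ρ k)) := by
  induction k with
  | zero => exact h0
  | succ k ih =>
    have hk := isProbDensity_of_isNormalizedSecondary hρ hsec k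
    have := hk.isProbabilityMeasure hI
    have := (hsec k).isProbDensity.isProbabilityMeasure hI
    exact ((hsec k).isSecondaryOperator_secondaryTransform hk hI ih).isPolynomialDense ih

/-- The two claims go through one induction: the orthogonality left after n + 1 transforms is what
cancels the correction term of the next one. -/
theorem iteratedTransform_spec (hI : MeasurableSet I) (hρ : IsProbDensity I (ρ 0))
    (hsec : ∀ k : ℕ, IsNormalizedSecondary I (ρ k) (ρ (k + 1)))
    (h0 : IsPolynomialDense (densMeasure I (ρ 0))) (n : ℕ) (g : L2 I (ρ 0)) :
    (∀ m, IsOrthogonalUpTo (densMeasure I (ρ 0)) (m + (n + 1)) g →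
      IsOrthogonalUpTo (densMeasure I (ρ (n + 1))) m (iteratedTransform I ρ n g)) ∧
    (IsOrthogonalUpTo (densMeasure I (ρ 0)) n g → ∀ f : L2 I (ρ 0),
      inner ℝ f g = (∏ k ∈ Finset.range (n + 1), d₀ I (ρ k)) *
        inner ℝ (iteratedTransform I ρ n f) (iteratedTransform I ρ n g)) := by
  have hprob := isProbDensity_of_isNormalizedSecondary hρ hsec
  have hdense := isPolynomialDense_of_isNormalizedSecondary hI hρ hsec h0
  have hinst (k : ℕ) : IsProbabilityMeasure (densMeasure I (ρ k)) :=
    (hprob k).isProbabilityMeasure hI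
  have hT (k : ℕ) := (hsec k).isSecondaryOperator_secondaryTransform (hprob k) hI (hdense k)
  have hd (k : ℕ) : d₀ I (ρ k) ≠ 0 := ((hprob k).d₀_pos hI (hdense k).hasMoments).ne'
  induction n with
  | zero =>
    refine ⟨fun m hg => (hT 0).isOrthogonalUpTo (hd 0) (hdense 0).hasMoments hg, fun hg f => ?_⟩
    have h1 := (hT 0).inner_apply_apply f g
    rw [hg.integral_eq_zero, mul_zero, sub_zero] at h1
    rw [Finset.prod_range_one, ← h1]
    rfl
  | succ n ih =>
    refine ⟨fun m hg => (hT (n + 1)).isOrthogonalUpTo (hd (n + 1)) (hdense (n + 1)).hasMoments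
      (ih.1 (m + 1) (by rwa [add_assoc, add_comm 1])), fun hg f => ?_⟩
    -- With m = 0 the remaining orthogonality is to constants only, exactly what the next stage
    -- needs.
    have hg0 := (ih.1 0 (by rwa [zero_add])).integral_eq_zero
    have h1 := (hT (n + 1)).inner_apply_apply (iteratedTransform I ρ n f)
      (iteratedTransform I ρ n g)
    rw [hg0, mul_zero, sub_zero] at h1
    rw [ih.2 (fun j hj => hg j (by omega)) f, ← h1, Finset.prod_range_succ _ (n + 1), mul_assoc]
    rfl

end

lemma isPolynomialDense_of_hilbertBasis {μ : Measure ℝ} {P : ℕ → ℝ[X]}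
    (hdeg : ∀ k : ℕ, (P k).degree = (k : WithBot ℕ)) (b : HilbertBasis ℕ ℝ (Lp ℝ 2 μ))
    (hb : ∀ k : ℕ, (b k : ℝ → ℝ) =ᵐ[μ] (fun x => (P k).eval x)) : IsPolynomialDense μ where
  hasMoments p := by
    let W : Submodule ℝ ℝ[X] :=
      { carrier := {p | MemLp (fun x => p.eval x) 2 μ}
        zero_mem' := by simp
        add_mem' := fun {p q} hp hq => by
          simp only [Set.mem_ofPred_eq, eval_add]
          exact MemLp.add hp hq
        smul_mem' := fun a p hp => by
          simp only [Set.mem_ofPred_eq, eval_smul, smul_eq_mul]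
          exact MemLp.const_mul hp a }
    refine mem_of_degree_lt hdeg W (p.natDegree + 1) (fun k _ => ?_) p ?_
    · exact (memLp_congr_ae (hb k)).1 (Lp.memLp (b k))
    · exact degree_le_natDegree.trans_lt (by exact_mod_cast Nat.lt_succ_self _)
  dense := by
    have h1 := Submodule.dense_iff_topologicalClosure_eq_top.2 b.dense_span
    refine h1.mono (Submodule.span_le.2 ?_)
    rintro _ ⟨k, rfl⟩
    exact ⟨P k, hb k⟩

lemma isOrthogonalUpTo_of_inner_eq_zero {μ : Measure ℝ} (hm : HasMoments μ) {P : ℕ → ℝ[X]}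
    (hdeg : ∀ k : ℕ, (P k).degree = (k : WithBot ℕ)) {b : ℕ → Lp ℝ 2 μ}
    (hb : ∀ k : ℕ, (b k : ℝ → ℝ) =ᵐ[μ] (fun x => (P k).eval x)) {n : ℕ} {g : Lp ℝ 2 μ}
    (hg : ∀ k ≤ n, inner ℝ g (b k) = 0) : IsOrthogonalUpTo μ n g := by
  intro j hj
  have hi (p : ℝ[X]) : Integrable (fun t => p.eval t * g t) μ :=
    (hm p).integrable_mul (Lp.memLp g)
  let W : Submodule ℝ ℝ[X] :=
    { carrier := {p | ∫ t, p.eval t * g t ∂μ = 0}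
      zero_mem' := by simp
      add_mem' := fun {p q} hp hq => by
        simp only [Set.mem_ofPred_eq, eval_add, add_mul] at *
        rw [integral_add (hi p) (hi q), hp, hq, add_zero]
      smul_mem' := fun a p hp => by
        simp only [Set.mem_ofPred_eq, eval_smul, smul_eq_mul, mul_assoc] at *
        rw [integral_const_mul, hp, mul_zero] }
  have h1 : (X ^ j : ℝ[X]) ∈ W := by
    refine mem_of_degree_lt hdeg W (n + 1) (fun k hk => ?_) _ ?_
    · change ∫ t, (P k).eval t * g t ∂μ = 0
      rw [← inner_eq_integral_mul (hb k), real_inner_comm]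
      exact hg k (by omega)
    · rw [degree_X_pow]
      exact_mod_cast Nat.lt_succ_of_le hj
  simpa [W] using h1

end SecondaryMeasure

theorem mainTheorem4 (I : Set ℝ) (hI : I.OrdConnected) (ρ : ℕ → ℝ → ℝ)
    (hρ : SecondaryMeasure.IsProbDensity I (ρ 0))
    (hsec : ∀ k : ℕ, SecondaryMeasure.IsNormalizedSecondary I (ρ k) (ρ (k + 1)))
    (P : ℕ → Polynomial ℝ) (hdeg : ∀ k : ℕ, (P k).degree = (k : WithBot ℕ))
    (b : HilbertBasis ℕ ℝ (SecondaryMeasure.L2 I (ρ 0)))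
    (hb : ∀ k : ℕ, (b k : ℝ → ℝ) =ᵐ[SecondaryMeasure.densMeasure I (ρ 0)]
      (fun x => (P k).eval x)) :
    (∀ k : ℕ, ∃! T : SecondaryMeasure.L2 I (ρ k) →L[ℝ] SecondaryMeasure.L2 I (ρ (k + 1)),
      SecondaryMeasure.IsSecondaryTransform I (ρ k) (ρ (k + 1)) T) ∧
    ∀ (n : ℕ) (f g : SecondaryMeasure.L2 I (ρ 0)),
      (∀ k ≤ n, inner ℝ g (b k) = 0) →
      inner ℝ f g =
        (∏ k ∈ Finset.range (n + 1), SecondaryMeasure.d₀ I (ρ k)) *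
          inner ℝ (SecondaryMeasure.iteratedTransform I ρ n f)
            (SecondaryMeasure.iteratedTransform I ρ n g) := by
  have hm := hI.measurableSet
  have h0 := SecondaryMeasure.isPolynomialDense_of_hilbertBasis hdeg b hb
  refine ⟨fun k => (hsec k).existsUnique_transform
    (SecondaryMeasure.isProbDensity_of_isNormalizedSecondary hρ hsec k) hm
    (SecondaryMeasure.isPolynomialDense_of_isNormalizedSecondary hm hρ hsec h0 k),
    fun n f g hg => ?_⟩
  exact (SecondaryMeasure.iteratedTransform_spec hm hρ hsec h0 n g).2
    (SecondaryMeasure.isOrthogonalUpTo_of_inner_eq_zero h0.hasMoments hdeg hb hg) f
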